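/- Consider a base station with a uniform linear array of $N\ge 1$ antennas serving $K$ single-antenna users with channels $\mathbf g_k\in\mathbb C^N$ and noise variances $\sigma_{\mathrm U_k}^2>0$, in the presence of a potential eavesdropper with noise variance $\sigma_{\mathrm E}^2>0$, estimated angle $\bar\theta$ with maximum error $\psi$, and estimated distance $\bar d$ with maximum error $D$, $0\le D<\bar d$. Let $P^{\max}>0$, $\iota\ge 0$, $0\le T_{\mathrm s}<T_{\mathrm{tot}}$, leakage tolerances $C_k^{\mathrm{tol}}>0$, sampled directions $\vartheta_1,\dots,\vartheta_L$, normalized antenna spacing $\omega$ and wavelength $\lambda$ be given, and put $\mathbf G_k=\mathbf g_k\mathbf g_k^H$, $\beta=(\lambda/4\pi)^2$, $\bar c_k=2^{C_k^{\mathrm{tol}}T_{\mathrm{tot}}/(T_{\mathrm{tot}}-T_{\mathrm s})}-1$, $\mathbf a(\theta)=\big(e^{\jmath 2\pi\omega n\sin\theta}\big)_{n=0}^{N-1}$, $\mathbf a^{(1)}(\theta)=\big(\jmath 2\pi n\omega\cos\theta\; e^{\jmath 2\pi\omega n\sin\theta}\big)_{n=0}^{N-1}$, $\mathbf U=[\mathbf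 a^{(1)}(\bar\theta)\ \ \mathbf a(\bar\theta)]$, and $P(\vartheta_l)=1$ if $|\vartheta_l-\bar\theta|\le|\psi|$ and $P(\vartheta_l)=0$ otherwise. For a projection parameter $\varpi\in\mathbb R$ and a vertex $\mathbf v\in\mathbb R^K$, consider the feasibility problem of finding Hermitian positive semidefinite $N\times N$ matrices $\mathbf W_1,\dots,\mathbf W_K,\mathbf Z$ and reals $\zeta,\tau_k,\kappa_k\ge 0,\varrho_k\ge 0$ such that, for all $k$, - C1: $\sum_{j}\mathrm{Tr}(\mathbf W_j)+\mathrm{Tr}(\mathbf Z)\le P^{\max}$; - C2: $\sum_{l=1}^L\big|\zeta P(\vartheta_l)-\mathbf a^H(\vartheta_l)\mathbf Z\mathbf a(\vartheta_l)\big|\le\iota$; - C3a: $\begin{bmatrix}\kappa_k&0\\0&\tau_k-\kappa_k\psi^2\end{bmatrix}-\mathbf U^H(\mathbf W_k-\bar c_k\mathbf Z)\mathbf U\succeq\mathbf 0$; - C3b: $\begin{bmatrix}\varrho_k+\bar c_k\sigma_{\mathrm E}^2&\bar c_k\bar d\sigma_{\mathrm E}^2\\ \bar c_k\bar d\sigma_{\mathrm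 E}^2&-\varrho_kD^2-\tau_k\beta+\bar c_k\bar d^2\sigma_{\mathrm E}^2\end{bmatrix}\succeq\mathbf 0$; - C5: $\mathrm{Rank}(\mathbf W_k)\le 1$; - C6: $f_k-\varpi v_k\,g_k\ge 0$, where $g_k=\sum_{r\ne k}\mathrm{Tr}(\mathbf G_k\mathbf W_r)+\mathrm{Tr}(\mathbf G_k\mathbf Z)+\sigma_{\mathrm U_k}^2$ and $f_k=\mathrm{Tr}(\mathbf G_k\mathbf W_k)+g_k$. The relaxed problem is the same problem without C5. Then the relaxation is tight: the relaxed problem is feasible if and only if the original problem is. Moreover, whenever $(\mathbf W_k),\mathbf Z,\dots$ solves the relaxed problem, there is a solution $(\mathbf W_k^*),\mathbf Z^*,\dots$ of the relaxed problem with $\mathrm{Rank}(\mathbf W_k^*)\le 1$ for all $k$, and with $\mathrm{Rank}(\mathbf W_k^*)=1$ for every $k$ such that $\varpi v_k>1$ (that is, user $k$ has a positive SINR target) or $\mathbf W_k\ne\mathbf 0$. If $\varpi v_k\le 1$ for all $k$, the relaxed problem has a solution with $\mathrm{Rank}(\mathbf W_k^*)=1$ for all $k$. -/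

import Mathlib

open scoped ComplexOrder

noncomputable section

/-- Data of the secure two-phase ISAC system in its second phase: a base station with a uniform
linear array of `N` antennas, `K` single-antenna users, one potential eavesdropper (the sensed
target), and `L` sampled directions for the sensing beam pattern. -/
structure ISACSystem (N K L : ℕ) where
  /-- transmit power budget -/
  Pmax : ℝ
  /-- normalized antenna spacing -/
  spacing : ℝ
  /-- carrier wavelength -/
  wavelength : ℝ
  /-- channels between the base station and the users -/
  g : Fin K → Fin N → ℂ
  /-- noise standard deviations at the users -/
  sigmaU : Fin K → ℝ
  /-- noise standard deviation at the eavesdropper -/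
  sigmaE : ℝ
  /-- estimated angle of departure towards the eavesdropper -/
  thetaBar : ℝ
  /-- maximum angle uncertainty in the second phase -/
  psi : ℝ
  /-- estimated distance of the eavesdropper -/
  dBar : ℝ
  /-- maximum distance uncertainty -/
  D : ℝ
  /-- sampled directions -/
  dir : Fin L → ℝ
  /-- beam pattern mismatch tolerance -/
  iota : ℝ
  /-- duration of the time slot -/
  Ttot : ℝ
  /-- duration of the first phase -/
  Ts : ℝ
  /-- maximum tolerable information leakage of each user -/
  Ctol : Fin K → ℝ

/-- The optimization variables: beamforming matrices `W k`, covariance `Z` of the artificial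
noise, scaling factor `zeta` of the beam pattern and the slack variables. -/
structure ISACPoint (N K : ℕ) where
  W : Fin K → Matrix (Fin N) (Fin N) ℂ
  Z : Matrix (Fin N) (Fin N) ℂ
  zeta : ℝ
  tau : Fin K → ℝ
  kappa : Fin K → ℝ
  rho : Fin K → ℝ

namespace ISACSystem

variable {N K L : ℕ} (S : ISACSystem N K L)

/-- Steering vector `a(θ)`, with entries `exp(j 2π ω n sin θ)`, `n = 0, …, N - 1`. -/
def steering (θ : ℝ) : Fin N → ℂ := fun n =>
  Complex.exp (Complex.I * ((2 * Real.pi * S.spacing * (n : ℕ) * Real.sin θ : ℝ) : ℂ))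

/-- First-order Taylor coefficient of the steering vector at `θ`, with entries
`j 2π n ω cos θ · a(θ)_n`. -/
def steeringDeriv (θ : ℝ) : Fin N → ℂ := fun n =>
  Complex.I * ((2 * Real.pi * (n : ℕ) * S.spacing * Real.cos θ : ℝ) : ℂ) * S.steering θ n

/-- The `N × 2` matrix whose columns are the Taylor coefficients of order one and zero of the
steering vector at the estimated angle. -/
def Ua : Matrix (Fin N) (Fin 2) ℂ :=
  Matrix.of fun n => ![S.steeringDeriv S.thetaBar n, S.steering S.thetaBar n]

/-- The matrix `G_k = g_k g_kᴴ`. -/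
def G (k : Fin K) : Matrix (Fin N) (Fin N) ℂ := Matrix.vecMulVec (S.g k) (star (S.g k))

/-- The path loss constant `β = (λ / 4π)²`. -/
def beta : ℝ := (S.wavelength / (4 * Real.pi)) ^ 2

/-- `c̄_k = 2 ^ (C_k^tol T_tot / (T_tot - T_s)) - 1`. -/
def cBar (k : Fin K) : ℝ := (2 : ℝ) ^ (S.Ctol k * (S.Ttot / (S.Ttot - S.Ts))) - 1

/-- Ideal sensing beam pattern in the second phase. -/
def beam (l : Fin L) : ℝ := if |S.dir l - S.thetaBar| ≤ |S.psi| then 1 else 0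

/-- Useful power, interference, artificial noise and receiver noise at user `k`. -/
def f (x : ISACPoint N K) (k : Fin K) : ℝ :=
  ∑ j, (S.G k * x.W j).trace.re + (S.G k * x.Z).trace.re + S.sigmaU k ^ 2

/-- Interference, artificial noise and receiver noise at user `k`. -/
def gInt (x : ISACPoint N K) (k : Fin K) : ℝ :=
  ∑ r ∈ Finset.univ.erase k, (S.G k * x.W r).trace.re + (S.G k * x.Z).trace.re + S.sigmaU k ^ 2

/-- Power budget. -/
def C1 (x : ISACPoint N K) : Prop := ∑ k, (x.W k).trace.re + x.Z.trace.re ≤ S.Pmax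

/-- Beam pattern matching. -/
def C2 (x : ISACPoint N K) : Prop :=
  ∑ l, ‖((x.zeta * S.beam l : ℝ) : ℂ)
    - star (S.steering (S.dir l)) ⬝ᵥ (x.Z.mulVec (S.steering (S.dir l)))‖ ≤ S.iota

/-- Robust leakage constraint, angle part (linear matrix inequality). -/
def C3a (x : ISACPoint N K) : Prop := ∀ k,
  ((!![(x.kappa k : ℂ), 0; 0, ((x.tau k - x.kappa k * S.psi ^ 2 : ℝ) : ℂ)] :
      Matrix (Fin 2) (Fin 2) ℂ)
    - S.Ua.conjTranspose * (x.W k - (S.cBar k : ℂ) • x.Z) * S.Ua).PosSemidef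

/-- Robust leakage constraint, distance part (linear matrix inequality). -/
def C3b (x : ISACPoint N K) : Prop := ∀ k,
  (!![x.rho k + S.cBar k * S.sigmaE ^ 2, S.cBar k * S.dBar * S.sigmaE ^ 2;
      S.cBar k * S.dBar * S.sigmaE ^ 2,
      -(x.rho k * S.D ^ 2) - x.tau k * S.beta + S.cBar k * S.dBar ^ 2 * S.sigmaE ^ 2] :
      Matrix (Fin 2) (Fin 2) ℝ).PosSemidef

/-- SINR targets, for the projection parameter `w` and the polyblock vertex `v`. -/
def C6 (w : ℝ) (v : Fin K → ℝ) (x : ISACPoint N K) : Prop :=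
  ∀ k, 0 ≤ S.f x k - w * v k * S.gInt x k

/-- `x` solves the feasibility problem with the rank constraint dropped. As the problem has no
objective, its optimal solutions are its feasible points. -/
structure RelaxedSolution (w : ℝ) (v : Fin K → ℝ) (x : ISACPoint N K) : Prop where
  W_posSemidef : ∀ k, (x.W k).PosSemidef
  Z_posSemidef : x.Z.PosSemidef
  kappa_nonneg : ∀ k, 0 ≤ x.kappa k
  rho_nonneg : ∀ k, 0 ≤ x.rho k
  c1 : S.C1 x
  c2 : S.C2 x
  c3a : S.C3a x
  c3b : S.C3b x
  c6 : S.C6 w v x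

/-- `x` solves the feasibility problem with the rank constraint. -/
structure Solution (w : ℝ) (v : Fin K → ℝ) (x : ISACPoint N K) : Prop
    extends S.RelaxedSolution w v x where
  c5 : ∀ k, (x.W k).rank ≤ 1

end ISACSystem

end

/-! Apart from the useful power `g_kᴴ W_k g_k`, the constraints only improve when `W_k` shrinks in
the Loewner order with `Z` and the slacks fixed: power, leakage and interference are monotone in
`W_k`. So it suffices to find, below each `W_k`, a matrix of rank at most one with the same useful
power. `PosSemidef.exists_rank_one_le` supplies `W g gᴴ W / (gᴴ W g)`, which lies below `W` by
Cauchy-Schwarz; `RelaxedSolution.of_dominated` makes the replacement.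

When every SINR target is nonpositive, C6 holds automatically, so weak nonzero beams with `Z = 0`
suffice. The distance constraint leaves room for a positive `τ_k` because `D < d̄`. -/

namespace Matrix

variable {n : Type*} [Fintype n]

theorem eq_zero_of_rank_eq_zero {K : Type*} [Field K] {A : Matrix n n K}
    (h : A.rank = 0) : A = 0 := by
  classical
  rw [Matrix.rank, Submodule.finrank_eq_zero, LinearMap.range_eq_bot] at h
  ext i j
  have := congrFun (LinearMap.congr_fun h (Pi.single j 1)) i
  simpa using this

theorem trace_vecMulVec_star_mul (g : n → ℂ) (B : Matrix n n ℂ) :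
    (vecMulVec g (star g) * B).trace = star g ⬝ᵥ (B *ᵥ g) := by
  rw [vecMulVec_mul, trace_vecMulVec, dotProduct_comm, dotProduct_mulVec]

/-- Deflating a positive semidefinite matrix `A` along `u` leaves a positive semidefinite matrix. -/
theorem PosSemidef.sub_smul_vecMulVec_mulVec [DecidableEq n] {A : Matrix n n ℂ}
    (hA : A.PosSemidef) (u : n → ℂ) :
    (A - (star u ⬝ᵥ (A *ᵥ u))⁻¹ • vecMulVec (A *ᵥ u) (star (A *ᵥ u))).PosSemidef := by
  have hq0 : 0 ≤ star u ⬝ᵥ (A *ᵥ u) := hA.dotProduct_mulVec_nonneg u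
  set q := star u ⬝ᵥ (A *ᵥ u) with hq
  have hsq : star q = q := (IsSelfAdjoint.of_nonneg hq0).star_eq
  have hvu : star (A *ᵥ u) ⬝ᵥ u = q := by
    rw [hq, star_mulVec, hA.isHermitian.eq, dotProduct_mulVec]
  -- Since `0⁻¹ = 0`, the degenerate case `q = 0` needs no separate hypothesis.
  have hqq : q⁻¹ * (q⁻¹ * q) = q⁻¹ := by
    by_cases h : q = 0
    · simp [h]
    · simp [h]
  -- For `q ≠ 0` this is a congruence by the projection along `u` onto its `A`-orthogonal
  -- complement.
  have key := hA.conjTranspose_mul_mul_same (1 - q⁻¹ • vecMulVec u (star (A *ᵥ u)))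
  convert key using 1
  rw [conjTranspose_sub, conjTranspose_smul, conjTranspose_vecMulVec, star_star, conjTranspose_one,
    star_inv₀, hsq, sub_mul, one_mul, Matrix.smul_mul, vecMulVec_mul, ← hA.isHermitian.eq,
    ← star_mulVec, hA.isHermitian.eq, mul_sub, mul_one, sub_mul, Matrix.mul_smul, mul_vecMulVec,
    Matrix.smul_mul, Matrix.mul_smul, vecMulVec_mul_vecMulVec, hvu]
  simp only [vecMulVec_smul, smul_smul, hqq, sub_self, sub_zero]

theorem PosSemidef.smul_vecMulVec_mulVec {A : Matrix n n ℂ} (hA : A.PosSemidef) (u : n → ℂ) :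
    ((star u ⬝ᵥ (A *ᵥ u))⁻¹ • vecMulVec (A *ᵥ u) (star (A *ᵥ u))).PosSemidef :=
  (posSemidef_vecMulVec_self_star _).smul (inv_nonneg.2 (hA.dotProduct_mulVec_nonneg u))

/-- A positive semidefinite matrix dominates a matrix of rank at most one with the same value of
the quadratic form at a given vector. -/
theorem PosSemidef.exists_rank_one_le {A : Matrix n n ℂ} (hA : A.PosSemidef) (g : n → ℂ) :
    ∃ B : Matrix n n ℂ, B.PosSemidef ∧ (A - B).PosSemidef ∧ B.rank ≤ 1 ∧
      (A ≠ 0 → B.rank = 1) ∧ star g ⬝ᵥ (B *ᵥ g) = star g ⬝ᵥ (A *ᵥ g) := by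
  classical
  by_cases hA0 : A = 0
  · exact ⟨0, .zero, by simpa using hA, by simp, fun h => absurd hA0 h, by simp [hA0]⟩
  -- Deflating along `g` itself preserves the form at `g`. If `A g = 0` that would give the zero
  -- matrix, so any `u` outside the kernel is used instead, to keep rank one.
  obtain ⟨u, hu, hug⟩ : ∃ u, A *ᵥ u ≠ 0 ∧ (A *ᵥ g ≠ 0 → u = g) := by
    by_cases hg : A *ᵥ g = 0
    · by_contra! h
      refine hA0 (Matrix.ext fun i j => ?_)
      by_contra hij
      obtain ⟨h1, -⟩ := h (Pi.single j 1) fun h => hij (by simpa using congrFun h i)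
      exact h1 hg
    · exact ⟨g, hg, fun _ => rfl⟩
  set B := (star u ⬝ᵥ (A *ᵥ u))⁻¹ • vecMulVec (A *ᵥ u) (star (A *ᵥ u)) with hB
  have hBp : B.PosSemidef := hA.smul_vecMulVec_mulVec u
  have hABp : (A - B).PosSemidef := hA.sub_smul_vecMulVec_mulVec u
  have hq : star u ⬝ᵥ (A *ᵥ u) ≠ 0 := fun h => hu ((hA.dotProduct_mulVec_zero_iff u).1 h)
  have hle : B.rank ≤ 1 := by
    rw [hB, ← smul_vecMulVec]
    exact rank_vecMulVec_le _ _
  refine ⟨B, hBp, hABp, hle, fun _ => ?_, ?_⟩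
  · refine le_antisymm hle (Nat.one_le_iff_ne_zero.2 fun h => ?_)
    have := eq_zero_of_rank_eq_zero h
    rw [hB, smul_eq_zero, vecMulVec_eq_zero] at this
    simp [hq, hu] at this
  · by_cases hg : A *ᵥ g = 0
    -- The form of `B` at `g` is squeezed between `0` and that of `A`, which vanishes.
    · have h1 := hBp.dotProduct_mulVec_nonneg g
      have h2 := hABp.dotProduct_mulVec_nonneg g
      rw [sub_mulVec, dotProduct_sub, hg, dotProduct_zero, zero_sub, neg_nonneg] at h2
      rw [hg, dotProduct_zero]
      exact le_antisymm h2 h1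
    · obtain rfl := hug hg
      have hvu : star (A *ᵥ u) ⬝ᵥ u = star u ⬝ᵥ (A *ᵥ u) := by
        rw [star_mulVec, hA.isHermitian.eq, dotProduct_mulVec]
      rw [hB, smul_mulVec, vecMulVec_mulVec, hvu]
      simp [hq]

theorem posSemidef_fin_two_of_sq_le {a b c : ℝ} (ha : 0 < a) (h : b ^ 2 ≤ a * c) :
    (!![a, b; b, c] : Matrix (Fin 2) (Fin 2) ℝ).PosSemidef := by
  refine PosSemidef.of_dotProduct_mulVec_nonneg ?_ fun x => ?_
  · ext i j
    fin_cases i <;> fin_cases j <;> simp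
  · have hx : star x ⬝ᵥ (!![a, b; b, c] *ᵥ x)
        = a * x 0 ^ 2 + 2 * b * (x 0 * x 1) + c * x 1 ^ 2 := by
      simp [dotProduct, mulVec, Fin.sum_univ_two]
      ring
    rw [hx]
    -- Completing the square: `a` times the form is `(a x₀ + b x₁)² + (a c - b²) x₁²`.
    refine nonneg_of_mul_nonneg_right (a := a) ?_ ha
    nlinarith [sq_nonneg (a * x 0 + b * x 1), mul_nonneg (sub_nonneg.2 h) (sq_nonneg (x 1))]

end Matrix

/-- The distance constraint is strictly feasible when the distance error is below the distance. -/
theorem exists_slack_posSemidef {c s d D b : ℝ} (hc : 0 < c) (hs : 0 < s) (hD : 0 ≤ D)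
    (hd : D < d) (hb : 0 ≤ b) :
    ∃ r m : ℝ, 0 ≤ r ∧ 0 < m ∧ ∀ t, t ≤ m →
      (!![r + c * s, c * d * s; c * d * s, -(r * D ^ 2) - t * b + c * d ^ 2 * s] :
        Matrix (Fin 2) (Fin 2) ℝ).PosSemidef := by
  have hcs : 0 < c * s := mul_pos hc hs
  have hA : 0 < c * s * (d ^ 2 - D ^ 2) := mul_pos hcs (by nlinarith)
  set A := c * s * (d ^ 2 - D ^ 2) with hAdef
  -- The determinant at `t` is `r A - r² D² - t b (r + c s)`. This `r` keeps `r² D²` below `r A /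
  -- 2`, and `m` below keeps the `t` term below the other half; the `+ 1`s avoid division by zero.
  have hr : 0 < A / (2 * (D ^ 2 + 1)) := by positivity
  set r := A / (2 * (D ^ 2 + 1)) with hrdef
  have hrA : r * (D ^ 2 + 1) = A / 2 := by rw [hrdef]; field_simp
  have hm : 0 < r * A / (2 * (b + 1) * (r + c * s)) := by positivity
  set m := r * A / (2 * (b + 1) * (r + c * s)) with hmdef
  have hmA : m * (b + 1) * (r + c * s) = r * A / 2 := by rw [hmdef]; field_simp
  refine ⟨r, m, hr.le, hm, fun t ht => Matrix.posSemidef_fin_two_of_sq_le (by positivity) ?_⟩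
  have h1 : t * b * (r + c * s) ≤ r * A / 2 := by
    rw [← hmA]
    have : t * b ≤ m * (b + 1) := by nlinarith
    gcongr
  have h2 : r * (r * D ^ 2) ≤ r * (A / 2) := by gcongr; nlinarith
  have h3 : (r + c * s) * (-(r * D ^ 2) - t * b + c * d ^ 2 * s) - (c * d * s) ^ 2
      = r * A - r * (r * D ^ 2) - t * b * (r + c * s) := by rw [hAdef]; ring
  linarith

namespace ISACSystem

open Matrix

variable {N K L : ℕ} (S : ISACSystem N K L)

/-! ### Signal and interference under domination -/

theorem trace_G_mul_nonneg (k : Fin K) {B : Matrix (Fin N) (Fin N) ℂ} (hB : B.PosSemidef) :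
    0 ≤ (S.G k * B).trace.re := by
  rw [G, trace_vecMulVec_star_mul]
  exact (Complex.le_def.1 (hB.dotProduct_mulVec_nonneg _)).1

theorem f_eq_add_gInt (x : ISACPoint N K) (k : Fin K) :
    S.f x k = (S.G k * x.W k).trace.re + S.gInt x k := by
  rw [f, gInt, ← Finset.add_sum_erase _ _ (Finset.mem_univ k)]
  ring

theorem gInt_pos {x : ISACPoint N K} (hW : ∀ k, (x.W k).PosSemidef) (hZ : x.Z.PosSemidef)
    {k : Fin K} (hk : 0 < S.sigmaU k) : 0 < S.gInt x k := by
  have h1 := Finset.sum_nonneg fun r (_ : r ∈ Finset.univ.erase k) =>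
    S.trace_G_mul_nonneg k (hW r)
  have h2 := S.trace_G_mul_nonneg k hZ
  exact add_pos_of_nonneg_of_pos (add_nonneg h1 h2) (pow_pos hk 2)

theorem gInt_le_gInt {x y : ISACPoint N K} (hW : ∀ k, (x.W k - y.W k).PosSemidef)
    (hZ : y.Z = x.Z) (k : Fin K) : S.gInt y k ≤ S.gInt x k := by
  have h : ∀ r ∈ Finset.univ.erase k, (S.G k * y.W r).trace.re ≤ (S.G k * x.W r).trace.re :=
    fun r _ => by
      have := S.trace_G_mul_nonneg k (hW r)
      rwa [mul_sub, trace_sub, Complex.sub_re, sub_nonneg] at this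
  rw [gInt, gInt, hZ]
  gcongr ?_ + _ + _
  exact Finset.sum_le_sum h

/-- The margin is signal plus `(1 - c)` times interference. For `c ≤ 1` both terms are nonnegative;
for `c ≥ 1` less interference only helps. -/
theorem sinr_margin_nonneg {x y : ISACPoint N K} {k : Fin K} {c : ℝ}
    (hx : 0 ≤ S.f x k - c * S.gInt x k) (hy : 0 ≤ S.gInt y k) (hle : S.gInt y k ≤ S.gInt x k)
    (hy0 : 0 ≤ (S.G k * y.W k).trace.re)
    (hS : (S.G k * y.W k).trace.re = (S.G k * x.W k).trace.re) :
    0 ≤ S.f y k - c * S.gInt y k := by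
  rw [f_eq_add_gInt] at hx ⊢
  rcases le_total c 1 with hc | hc
  · linarith [mul_nonneg (sub_nonneg.2 hc) hy]
  · linarith [mul_nonneg (sub_nonneg.2 hc) (sub_nonneg.2 hle)]

theorem steering_zero_index (hN : 0 < N) (θ : ℝ) : S.steering θ ⟨0, hN⟩ = 1 := by
  simp [steering]

/-- Replacing each beamforming matrix by a dominated one with the same useful power keeps a
relaxed solution. -/
theorem RelaxedSolution.of_dominated {S : ISACSystem N K L} (hsigmaU : ∀ k, 0 < S.sigmaU k)
    {w : ℝ} {v : Fin K → ℝ} {x : ISACPoint N K} (hx : S.RelaxedSolution w v x)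
    {B : Fin K → Matrix (Fin N) (Fin N) ℂ} (hB : ∀ k, (B k).PosSemidef)
    (hsub : ∀ k, (x.W k - B k).PosSemidef)
    (hval : ∀ k, star (S.g k) ⬝ᵥ (B k *ᵥ S.g k) = star (S.g k) ⬝ᵥ (x.W k *ᵥ S.g k)) :
    S.RelaxedSolution w v ⟨B, x.Z, x.zeta, x.tau, x.kappa, x.rho⟩ where
  W_posSemidef := hB
  Z_posSemidef := hx.Z_posSemidef
  kappa_nonneg := hx.kappa_nonneg
  rho_nonneg := hx.rho_nonneg
  c1 := by
    have h : ∀ k ∈ Finset.univ, (B k).trace.re ≤ (x.W k).trace.re := fun k _ => by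
      have := (Complex.le_def.1 (hsub k).trace_nonneg).1
      rwa [trace_sub, Complex.sub_re, Complex.zero_re, sub_nonneg] at this
    have h1 := hx.c1
    rw [C1] at h1 ⊢
    linarith [Finset.sum_le_sum h]
  c2 := hx.c2
  c3a k := by
    -- Lowering `W k` to `B k` adds the positive semidefinite term `Uᴴ (W k - B k) U` to the old
    -- matrix.
    have := (hx.c3a k).add ((hsub k).conjTranspose_mul_mul_same S.Ua)
    convert this using 1
    simp only [Matrix.mul_sub, Matrix.sub_mul]
    abel
  c3b := hx.c3b
  c6 k := by
    refine S.sinr_margin_nonneg (hx.c6 k)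
      (S.gInt_pos (x := ⟨B, x.Z, x.zeta, x.tau, x.kappa, x.rho⟩) hB hx.Z_posSemidef (hsigmaU k)).le
      (S.gInt_le_gInt (x := x) (y := ⟨B, x.Z, x.zeta, x.tau, x.kappa, x.rho⟩) hsub rfl k)
      (S.trace_G_mul_nonneg k (hB k)) ?_
    rw [G, trace_vecMulVec_star_mul, trace_vecMulVec_star_mul, hval]

/-- With no beam the margin is `(1 - w v_k)` times an interference kept positive by the noise, hence
negative. -/
theorem RelaxedSolution.W_ne_zero {S : ISACSystem N K L} {w : ℝ} {v : Fin K → ℝ}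
    {x : ISACPoint N K} (hx : S.RelaxedSolution w v x) {k : Fin K} (hsigmaU : 0 < S.sigmaU k)
    (hk : 1 < w * v k) : x.W k ≠ 0 := by
  intro h0
  have h := hx.c6 k
  rw [f_eq_add_gInt, h0, mul_zero, trace_zero, Complex.zero_re] at h
  have := S.gInt_pos hx.W_posSemidef hx.Z_posSemidef hsigmaU
  linarith [mul_pos (sub_pos.2 hk) this]

theorem RelaxedSolution.exists_solution {S : ISACSystem N K L} (hsigmaU : ∀ k, 0 < S.sigmaU k)
    {w : ℝ} {v : Fin K → ℝ} {x : ISACPoint N K} (hx : S.RelaxedSolution w v x) :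
    ∃ y, S.Solution w v y ∧ ∀ k, (1 < w * v k ∨ x.W k ≠ 0) → (y.W k).rank = 1 := by
  choose B hB hsub hle hone hval using fun k => (hx.W_posSemidef k).exists_rank_one_le (S.g k)
  exact ⟨_, ⟨hx.of_dominated hsigmaU hB hsub hval, hle⟩, fun k hk =>
    hone k (hk.elim (hx.W_ne_zero (hsigmaU k)) id)⟩

/-! ### A unit-rank point when no SINR target is positive -/

theorem cBar_pos {k : Fin K} (hCtol : 0 < S.Ctol k) (hTs : 0 ≤ S.Ts) (hTtot : S.Ts < S.Ttot) :
    0 < S.cBar k := by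
  have h : 0 < S.Ctol k * (S.Ttot / (S.Ttot - S.Ts)) :=
    mul_pos hCtol (div_pos (hTs.trans_lt hTtot) (sub_pos.2 hTtot))
  have := Real.one_lt_rpow one_lt_two h
  rw [cBar]
  linarith

/-- If no user has a positive SINR target, then low-power beams through the reference antenna
without artificial noise are feasible. -/
theorem exists_solution_rank_eq_one (hN : 0 < N) (hPmax : 0 < S.Pmax)
    (hsigmaU : ∀ k, 0 < S.sigmaU k) (hsigmaE : 0 < S.sigmaE)
    (hCtol : ∀ k, 0 < S.Ctol k) (hTs : 0 ≤ S.Ts) (hTtot : S.Ts < S.Ttot)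
    (hD : 0 ≤ S.D) (hdBar : S.D < S.dBar) (hiota : 0 ≤ S.iota) {w : ℝ} {v : Fin K → ℝ}
    (hwv : ∀ k, w * v k ≤ 1) : ∃ y, S.Solution w v y ∧ ∀ k, (y.W k).rank = 1 := by
  have hex := fun k => exists_slack_posSemidef (S.cBar_pos (hCtol k) hTs hTtot)
    (pow_pos hsigmaE 2) hD hdBar (b := S.beta) (sq_nonneg _)
  choose r m hr hm hpsd using hex
  let e : Fin N → ℂ := Pi.single ⟨0, hN⟩ 1
  -- The first bound serves the distance constraint with `τ = ε`, the second splits the power budget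
  -- equally.
  let ε : Fin K → ℝ := fun k => min (m k) (S.Pmax / K)
  have hK : ∀ k : Fin K, (0 : ℝ) < K := fun k => Nat.cast_pos.2 k.pos
  have hε : ∀ k, 0 < ε k := fun k => lt_min (hm k) (div_pos hPmax (hK k))
  let y : ISACPoint N K :=
    { W := fun k => (ε k : ℂ) • vecMulVec e (star e)
      Z := 0
      zeta := 0
      tau := ε
      kappa := fun _ => 0
      rho := r }
  have hW : ∀ k, (y.W k).PosSemidef := fun k =>
    (posSemidef_vecMulVec_self_star e).smul (Complex.zero_le_real.2 (hε k).le)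
  have hle : ∀ k, (y.W k).rank ≤ 1 := fun k => by
    change ((ε k : ℂ) • vecMulVec e (star e)).rank ≤ 1
    rw [← smul_vecMulVec]
    exact rank_vecMulVec_le _ _
  have he : e ≠ 0 := by simp [e]
  refine ⟨y, ⟨⟨hW, .zero, fun _ => le_rfl, hr, ?_, ?_, fun k => ?_,
    fun k => hpsd k _ (min_le_left _ _),
    fun k => ?_⟩, hle⟩, fun k => le_antisymm (hle k) (Nat.one_le_iff_ne_zero.2 fun h => ?_)⟩
  · have htr : ∀ k, (y.W k).trace.re = ε k := fun k => by
      simp [y, e, trace_vecMulVec]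
    simp only [C1, htr]
    have : ∑ k, ε k ≤ ∑ _k : Fin K, S.Pmax / K := Finset.sum_le_sum fun k _ => min_le_right _ _
    rw [Finset.sum_const, Finset.card_univ, Fintype.card_fin, nsmul_eq_mul] at this
    simp only [y, trace_zero, Complex.zero_re, add_zero]
    refine this.trans ?_
    rcases (Nat.cast_nonneg K : (0 : ℝ) ≤ K).eq_or_lt with h | h
    · simpa [← h] using hPmax.le
    · rw [mul_div_cancel₀ _ h.ne']
  · simpa [C2, y] using hiota
  -- With `κ = 0` and `τ = ε` the angle matrix is exactly zero: at antenna index `0` the steering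
  -- entry is `1` and its derivative vanishes through the factor `n`.
  · convert PosSemidef.zero using 1
    have hU : S.Uaᴴ *ᵥ e = ![0, 1] := by
      ext i
      fin_cases i <;> simp [e, Ua, steeringDeriv, steering_zero_index]
    have hU' : star e ᵥ* S.Ua = ![0, 1] := by
      rw [← conjTranspose_conjTranspose S.Ua, ← star_mulVec, hU]
      ext i
      fin_cases i <;> simp
    simp only [y, smul_zero, sub_zero, Matrix.mul_smul, Matrix.smul_mul, mul_vecMulVec,
      vecMulVec_mul, hU, hU']
    ext i j
    fin_cases i <;> fin_cases j <;> simp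
  · rw [f_eq_add_gInt]
    have h1 := S.trace_G_mul_nonneg k (hW k)
    have h2 := S.gInt_pos hW (x := y) .zero (hsigmaU k)
    linarith [mul_nonneg (sub_nonneg.2 (hwv k)) h2.le]
  · have := eq_zero_of_rank_eq_zero h
    simp [y, he, (hε k).ne'] at this

end ISACSystem

theorem theorem1 {N K L : ℕ} (hN : 0 < N) (S : ISACSystem N K L)
    (hPmax : 0 < S.Pmax) (hsigmaU : ∀ k, 0 < S.sigmaU k) (hsigmaE : 0 < S.sigmaE)
    (hCtol : ∀ k, 0 < S.Ctol k) (hTs : 0 ≤ S.Ts) (hTtot : S.Ts < S.Ttot)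
    (hD : 0 ≤ S.D) (hdBar : S.D < S.dBar) (hiota : 0 ≤ S.iota)
    (w : ℝ) (v : Fin K → ℝ) :
    -- the relaxation is tight
    ((∃ x, S.RelaxedSolution w v x) ↔ ∃ x, S.Solution w v x) ∧
    -- unit-rank solutions are obtained from any solution of the relaxed problem
    (∀ x, S.RelaxedSolution w v x →
      ∃ y, S.Solution w v y ∧ ∀ k, (1 < w * v k ∨ x.W k ≠ 0) → (y.W k).rank = 1) ∧
    -- if no user has a positive SINR target, the relaxed problem has a unit-rank solution
    ((∀ k, w * v k ≤ 1) → ∃ y, S.Solution w v y ∧ ∀ k, (y.W k).rank = 1) := by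
  have key : ∀ x, S.RelaxedSolution w v x → _ := fun x hx => hx.exists_solution hsigmaU
  refine ⟨⟨fun ⟨x, hx⟩ => ?_, fun ⟨x, hx⟩ => ⟨x, hx.toRelaxedSolution⟩⟩, key, fun hwv =>
    S.exists_solution_rank_eq_one hN hPmax hsigmaU hsigmaE hCtol hTs hTtot hD hdBar hiota hwv⟩
  obtain ⟨y, hy, -⟩ := key x hx
  exact ⟨y, hy⟩
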